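/- Let $G=(V,E)$ be a finite connected loopless multigraph. For a rate vector $\lambda=(\lambda_e)_{e\in E}$ with all $\lambda_e>0$, let the edge weights $w=(w(e))_{e\in E}$ be independent with $w(e)$ exponentially distributed with rate $\lambda_e$, and let $\tilde w=(\tilde w(e))_{e\in E}$ be an independent copy of $w$ (one sample per edge). For $T\subseteq E$ write $w(T)=\sum_{e\in T}w(e)$. Let $\mathrm{OPT}=\min_T \mathbb E[w(T)]$, the minimum being over all spanning trees $T$ of $G$, and let $T^{\mathrm{SAM}}=T^{\mathrm{SAM}}(\tilde w)$ be the output of the sampling based algorithm, that is, a spanning tree $T$ minimizing $\tilde w(T)$ (ties being broken by an arbitrary fixed rule). A bond of $G$ is an inclusion-wise minimal set of edges whose removal increases the number of connected components, and $b$ is the size of a largest bond of $G$ ($b=0$ if $|V|=1$). Then, for every rate vector $\lambda$, the expected cost $\mathbb E[w(T^{\mathrm{SAM}})]=\mathbb E_{\tilde w}\mathbb E_{w}[w(T^{\mathrm{SAM}}(\tilde w))]$ is well defined and $$\mathbb E[w(T^{\mathrm{SAM}})]\le b\cdot \mathrm{OPT}.$$ Conversely, for every such $G$ and every $\varepsilon>0$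 there is a rate vector $\lambda$ with all $\lambda_e>0$ such that $$\mathbb E[w(T^{\mathrm{SAM}})]\ge (b-\varepsilon)\cdot \mathrm{OPT}.$$ -/

import Mathlib

open MeasureTheory ProbabilityTheory
open scoped Graph

noncomputable section

namespace Graph

variable {α β : Type*}

/-- A multigraph is connected if it has a vertex and any two vertices are joined by a walk. Loops
and parallel edges are irrelevant for this, so it is connectedness of the underlying simple
graph. -/
def IsConnected (G : Graph α β) : Prop := G.toSimpleGraph.Connected

/-- The number of connected components of a multigraph (with finitely many vertices). -/
def numComponents (G : Graph α β) : ℕ := Nat.card G.toSimpleGraph.ConnectedComponent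

/-- A cut set: a set of edges whose removal increases the number of connected components. -/
def IsCutSet (G : Graph α β) (F : Set β) : Prop :=
  F ⊆ E(G) ∧ G.numComponents < (G.deleteEdges F).numComponents

/-- A bond: an inclusion-wise minimal cut set. -/
def IsBond (G : Graph α β) (F : Set β) : Prop := Minimal G.IsCutSet F

/-- The size of a largest bond of a finite multigraph (`0` if there is no bond at all, as for the
graph with a single vertex). -/
def maxBondSize (G : Graph α β) : ℕ := sSup {n | ∃ F, G.IsBond F ∧ F.ncard = n}

/-- A cycle of length `k + 1`: a set of distinct edges `e 0, …, e k`, where `e i` has the ends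
`u i` and `u (i + 1)`, indices being read modulo `k + 1`. In particular a loop is a cycle of
length 1, and two parallel edges form a cycle of length 2. -/
def IsCycle (G : Graph α β) (C : Set β) : Prop :=
  ∃ (k : ℕ) (e : Fin (k + 1) → β) (u : Fin (k + 1) → α),
    Function.Injective e ∧ (∀ i, G.IsLink (e i) (u i) (u (i + 1))) ∧ Set.range e = C

/-- A spanning tree: a set of `|V| - 1` edges that contains no cycle. -/
def IsSpanningTree (G : Graph α β) (T : Finset E(G)) : Prop :=
  T.card + 1 = V(G).ncard ∧
    ∀ C, G.IsCycle C → ¬ C ⊆ (Subtype.val '' (T : Set E(G)) : Set β)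

/-- The total weight `w(T)` of a set `T` of edges. -/
def weight {G : Graph α β} (w : E(G) → ℝ) (T : Finset E(G)) : ℝ := ∑ e ∈ T, w e

/-- A minimum spanning tree for the edge weights `w`. -/
def IsMST (G : Graph α β) (w : E(G) → ℝ) (T : Finset E(G)) : Prop :=
  G.IsSpanningTree T ∧ ∀ T', G.IsSpanningTree T' → weight w T ≤ weight w T'

/-- The sampling based algorithm: a rule that, given a vector of sampled edge weights, outputs a
minimum spanning tree for it, with an arbitrary way of breaking ties. -/
def IsSAM (G : Graph α β) (A : (E(G) → ℝ) → Finset E(G)) : Prop := ∀ s, G.IsMST s (A s)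

/-- The law of the vector of independent edge weights, that of the edge `e` being exponential with
rate `r e`. -/
def weightLaw (G : Graph α β) [Fintype E(G)] (r : E(G) → ℝ) : Measure (E(G) → ℝ) :=
  Measure.pi fun e => expMeasure (r e)

/-- The expected cost of the rule `A`: the outer expectation is over the sampled weights `s`, the
inner one over the actual weights `w`, which are independent of the sample and have the same
law. -/
def expectedCost (G : Graph α β) [Fintype E(G)] (r : E(G) → ℝ)
    (A : (E(G) → ℝ) → Finset E(G)) : ℝ :=
  ∫ s, (∫ w, weight w (A s) ∂(G.weightLaw r)) ∂(G.weightLaw r)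

/-- The non-adaptive optimum: the minimum expected weight of a spanning tree (the infimum runs over
a finite set, which is nonempty for a connected finite graph). -/
def opt (G : Graph α β) [Fintype E(G)] (r : E(G) → ℝ) : ℝ :=
  sInf {c | ∃ T, G.IsSpanningTree T ∧ c = ∫ w, weight w T ∂(G.weightLaw r)}

end Graph

end

/-! Fix all sampled weights but that of `e`. The minimum weight, as a function of x = s e, is min(x
+ a, b), where a and b come from the best trees with and without `e`; off ties, `e` is chosen
exactly when x < c = b - a. For an exponential variable of rate r the density is r times the tail,
whence P(x < c) = r E[min(x, c) - min(0, c)]. The bracket is the `contribution` of `e`: the drop of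
the minimum weight when s e is set to 0. Averaging over the other weights (`measure_mem_optimal`),
P(e chosen) / r e is the mean contribution of `e`, so the expected cost of the algorithm is the sum
over e of E[contribution e] (`IsSAM.expectedCost_eq`).

Upper bound: let T be a minimum spanning tree for s. By symmetric exchange, the contribution of e is
at most s f for some f in T such that T - f + e is a spanning tree. For fixed f the admissible e
form a bond, so the contributions add up to at most b times the minimum weight
(`sum_contribution_le`), and the mean of the minimum is at most the minimum of the means.

Lower bound: each edge of a bond F contributes at least the minimum of s over F (`le_contribution`),
whose mean is the inverse of the total rate of F. Hence the cost is at least |F| / (total rate of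
F). For a largest bond, let one edge of F have rate 1, the others tiny rates, and the edges outside
F huge rates: the total rate of F is then about 1, and a tree meeting F only in that one edge costs
about 1. -/

noncomputable section

/-! ### Connectivity of the spanning subgraph given by a set of edges -/

namespace Graph

variable {α β : Type*} {G : Graph α β}

/-- The simple graph on the vertices of `G` whose adjacencies are witnessed by edges in `S`. -/
def spanSimple (G : Graph α β) (S : Set E(G)) : SimpleGraph V(G) where
  Adj u v := u ≠ v ∧ ∃ e ∈ S, G.IsLink e.1 u v
  symm := ⟨fun _ _ h => ⟨h.1.symm, h.2.imp fun _ he => ⟨he.1, he.2.symm⟩⟩⟩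

lemma spanSimple_mono {S S' : Set E(G)} (h : S ⊆ S') : G.spanSimple S ≤ G.spanSimple S' :=
  fun _ _ huv => ⟨huv.1, huv.2.imp fun _ he => ⟨h he.1, he.2⟩⟩

lemma exists_ends (e : E(G)) : ∃ x y : V(G), G.IsLink e.1 x y := by
  obtain ⟨x, y, h⟩ := exists_isLink_of_mem_edgeSet e.2
  exact ⟨⟨x, h.left_mem⟩, ⟨y, h.right_mem⟩, h⟩

lemma spanSimple_reachable_of_isLink {S : Set E(G)} {e : E(G)} (he : e ∈ S) {x y : V(G)}
    (h : G.IsLink e.1 x y) : (G.spanSimple S).Reachable x y := by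
  by_cases hxy : x = y
  · rw [hxy]
  · exact SimpleGraph.Adj.reachable ⟨hxy, e, he, h⟩

lemma spanSimple_reachable_of_forall {S S' : Set E(G)}
    (h : ∀ e ∈ S, ∀ x y : V(G), G.IsLink e.1 x y → (G.spanSimple S').Reachable x y)
    {u v : V(G)} (huv : (G.spanSimple S).Reachable u v) : (G.spanSimple S').Reachable u v := by
  obtain ⟨p⟩ := huv
  induction p with
  | nil => rfl
  | cons hadj _ ih =>
    obtain ⟨e, he, hl⟩ := hadj.2
    exact (h e he _ _ hl).trans ih

lemma spanSimple_reachable_of_forall_link {S S' : Set E(G)}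
    (h : ∀ e ∈ S, ∃ x y : V(G), G.IsLink e.1 x y ∧ (G.spanSimple S').Reachable x y)
    {u v : V(G)} (huv : (G.spanSimple S).Reachable u v) : (G.spanSimple S').Reachable u v := by
  refine spanSimple_reachable_of_forall (fun e he x y hl => ?_) huv
  obtain ⟨x', y', hl', hr⟩ := h e he
  rcases hl.eq_and_eq_or_eq_and_eq hl' with ⟨h1, h2⟩ | ⟨h1, h2⟩
  · rwa [Subtype.ext h1, Subtype.ext h2]
  · rw [Subtype.ext h1, Subtype.ext h2]; exact hr.symm

/-- A walk may use `f` many times, but crossings in opposite directions cancel and repeated ones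
collapse, so at most one crossing, in one of two directions, remains. -/
lemma spanSimple_reachable_insert {S : Set E(G)} {f : E(G)} {x y u v : V(G)}
    (hf : G.IsLink f.1 x y) (h : (G.spanSimple (insert f S)).Reachable u v) :
    (G.spanSimple S).Reachable u v ∨
      ((G.spanSimple S).Reachable u x ∧ (G.spanSimple S).Reachable y v) ∨
      ((G.spanSimple S).Reachable u y ∧ (G.spanSimple S).Reachable x v) := by
  obtain ⟨p⟩ := h
  induction p with
  | nil => exact Or.inl (SimpleGraph.Reachable.refl _)
  | @cons a b c hadj _ ih =>
    obtain ⟨e, he, hl⟩ := hadj.2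
    rcases he with rfl | he
    · rcases hl.eq_and_eq_or_eq_and_eq hf with ⟨h1, h2⟩ | ⟨h1, h2⟩
      · obtain rfl := Subtype.ext h1
        obtain rfl := Subtype.ext h2
        rcases ih with h | ⟨_, h⟩ | ⟨_, h⟩
        · exact Or.inr (Or.inl ⟨.refl _, h⟩)
        · exact Or.inr (Or.inl ⟨.refl _, h⟩)
        · exact Or.inl h
      · obtain rfl := Subtype.ext h1
        obtain rfl := Subtype.ext h2
        rcases ih with h | ⟨_, h⟩ | ⟨_, h⟩
        · exact Or.inr (Or.inr ⟨.refl _, h⟩)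
        · exact Or.inl h
        · exact Or.inr (Or.inr ⟨.refl _, h⟩)
    · have hab := spanSimple_reachable_of_isLink he hl
      rcases ih with h | ⟨h, h'⟩ | ⟨h, h'⟩
      · exact Or.inl (hab.trans h)
      · exact Or.inr (Or.inl ⟨hab.trans h, h'⟩)
      · exact Or.inr (Or.inr ⟨hab.trans h, h'⟩)

lemma spanSimple_connected_of_forall_link {S S' : Set E(G)} (hS : (G.spanSimple S).Connected)
    (h : ∀ e ∈ S, ∃ x y : V(G), G.IsLink e.1 x y ∧ (G.spanSimple S').Reachable x y) :
    (G.spanSimple S').Connected := by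
  have := hS.nonempty
  exact ⟨fun u v => spanSimple_reachable_of_forall_link h (hS.preconnected u v)⟩

/-- If adding `f` to `S` makes a connected graph, so does adding any edge whose ends are not yet
joined. -/
lemma spanSimple_connected_insert_of_not_reachable {S : Set E(G)} {e f : E(G)} {a b : V(G)}
    (h : (G.spanSimple (insert f S)).Connected) (he : G.IsLink e.1 a b)
    (hab : ¬ (G.spanSimple S).Reachable a b) : (G.spanSimple (insert e S)).Connected := by
  obtain ⟨x, y, hf⟩ := exists_ends f
  have hle : G.spanSimple S ≤ G.spanSimple (insert e S) := spanSimple_mono (Set.subset_insert _ _)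
  have he' : (G.spanSimple (insert e S)).Reachable a b :=
    spanSimple_reachable_of_isLink (Set.mem_insert _ _) he
  refine spanSimple_connected_of_forall_link h fun g hg => ?_
  rcases hg with rfl | hg
  · refine ⟨x, y, hf, ?_⟩
    rcases spanSimple_reachable_insert hf (h.preconnected a b) with h | ⟨h1, h2⟩ | ⟨h1, h2⟩
    · exact absurd h hab
    · exact (h1.mono hle).symm.trans (he'.trans (h2.mono hle).symm)
    · exact (h2.mono hle).trans (he'.symm.trans (h1.mono hle))
  · obtain ⟨x', y', hg'⟩ := exists_ends g
    exact ⟨x', y', hg', spanSimple_reachable_of_isLink (Set.mem_insert_of_mem _ hg) hg'⟩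

lemma spanSimple_connected_of_insert {S : Set E(G)} {e : E(G)} {a b : V(G)}
    (h : (G.spanSimple (insert e S)).Connected) (he : G.IsLink e.1 a b)
    (hab : (G.spanSimple S).Reachable a b) : (G.spanSimple S).Connected := by
  refine spanSimple_connected_of_forall_link h fun g hg => ?_
  rcases hg with rfl | hg
  · exact ⟨a, b, he, hab⟩
  · obtain ⟨x', y', hg'⟩ := exists_ends g
    exact ⟨x', y', hg', spanSimple_reachable_of_isLink hg hg'⟩

/-! ### Counting edges of connected spanning subgraphs -/

/-- An unordered pair of ends of an edge. -/
def endPair (G : Graph α β) (e : E(G)) : Sym2 V(G) :=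
  s((exists_ends e).choose, (exists_ends e).choose_spec.choose)

lemma endPair_eq {e : E(G)} {x y : V(G)} (h : G.IsLink e.1 x y) : G.endPair e = s(x, y) := by
  have h' := (exists_ends e).choose_spec.choose_spec
  rw [endPair, Sym2.eq_iff]
  rcases h'.eq_and_eq_or_eq_and_eq h with ⟨h1, h2⟩ | ⟨h1, h2⟩
  · exact Or.inl ⟨Subtype.ext h1, Subtype.ext h2⟩
  · exact Or.inr ⟨Subtype.ext h1, Subtype.ext h2⟩

lemma spanSimple_edgeSet_subset (S : Set E(G)) : (G.spanSimple S).edgeSet ⊆ G.endPair '' S := by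
  intro p hp
  induction p with
  | h x y =>
    obtain ⟨_, e, he, hl⟩ := hp
    exact ⟨e, he, endPair_eq hl⟩

lemma ncard_vertexSet_le_of_connected [Fintype E(G)] {T : Finset E(G)}
    (h : (G.spanSimple T).Connected) : V(G).ncard ≤ T.card + 1 := by
  have h1 := h.card_vert_le_card_edgeSet_add_one
  have h2 : (G.spanSimple T).edgeSet.ncard ≤ T.card :=
    (Set.ncard_le_ncard (spanSimple_edgeSet_subset _) (Set.toFinite _)).trans
      ((Set.ncard_image_le T.finite_toSet).trans (Set.ncard_coe_finset T).le)
  rw [Nat.card_coe_set_eq, Nat.card_coe_set_eq] at h1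
  omega

/-- Take a spanning tree of the simple graph and choose one edge of `S` for each of its adjacencies;
the choice is injective because an edge determines its pair of ends. -/
lemma exists_tree_subset [Fintype E(G)] {S : Set E(G)} (hV : V(G).Finite)
    (h : (G.spanSimple S).Connected) :
    ∃ T : Finset E(G), (T : Set E(G)) ⊆ S ∧ (G.spanSimple T).Connected ∧
      T.card + 1 = V(G).ncard := by
  classical
  obtain ⟨H, hle, hH⟩ := h.exists_isTree_le
  have : Finite V(G) := hV
  have hH' := SimpleGraph.isTree_iff_connected_and_card.1 hH
  have hex : ∀ p : H.edgeSet, ∃ e ∈ S, G.endPair e = p := fun p =>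
    spanSimple_edgeSet_subset S (SimpleGraph.edgeSet_mono hle p.2)
  choose c hc hc' using hex
  have hinj : Function.Injective c := fun p q hpq => Subtype.ext (by rw [← hc' p, ← hc' q, hpq])
  have hfin : (Set.range c).Finite := Set.toFinite _
  refine ⟨hfin.toFinset, ?_, ?_, ?_⟩
  · simpa [Set.range_subset_iff] using hc
  · refine hH'.1.mono fun u v huv => ⟨huv.ne, c ⟨s(u, v), huv⟩, by simp, ?_⟩
    have h1 := hc' ⟨s(u, v), huv⟩
    obtain ⟨x, y, hl⟩ := exists_ends (c ⟨s(u, v), huv⟩)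
    rw [endPair_eq hl, Sym2.eq_iff] at h1
    rcases h1 with ⟨rfl, rfl⟩ | ⟨rfl, rfl⟩
    · exact hl
    · exact hl.symm
  · rw [← Set.ncard_eq_toFinset_card, ← Set.image_univ, Set.ncard_image_of_injective _ hinj,
      Set.ncard_univ, ← Nat.card_coe_set_eq V(G)]
    exact hH'.2

/-! ### Cycles, and spanning trees as connected sets of |V| - 1 edges -/

/-- Removing an edge of a cycle keeps its ends connected. -/
lemma IsCycle.reachable_erase {C : Set β} (hC : G.IsCycle C) {g : E(G)} (hg : g.1 ∈ C) :
    ∃ x y : V(G), G.IsLink g.1 x y ∧ (G.spanSimple {f | f.1 ∈ C ∧ f ≠ g}).Reachable x y := by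
  obtain ⟨k, e, u, hinj, hl, rfl⟩ := hC
  obtain ⟨j, hj⟩ := hg
  -- Rotate the indices so that `g` becomes the last edge; the edges before it then form a walk
  -- between its ends, and injectivity of `e` keeps them distinct from `g`.
  let e' : Fin (k + 1) → E(G) := fun i => ⟨e (i + (j + 1)), (hl _).edge_mem⟩
  let u' : Fin (k + 1) → V(G) := fun i => ⟨u (i + (j + 1)), (hl _).left_mem⟩
  have hl' : ∀ i, G.IsLink (e' i).1 (u' i) (u' (i + 1)) := fun i => by
    have := hl (i + (j + 1))
    rwa [add_right_comm] at this
  have hlast : e' (Fin.last k) = g := Subtype.ext <| by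
    rw [← hj]
    change e (Fin.last k + (j + 1)) = e j
    rw [add_comm j, ← add_assoc, Fin.last_add_one, zero_add]
  refine ⟨u' (Fin.last k), u' (Fin.last k + 1), hlast ▸ hl' _, ?_⟩
  rw [Fin.last_add_one]
  symm
  have key : ∀ i : Fin (k + 1),
      (G.spanSimple {f | f.1 ∈ Set.range e ∧ f ≠ g}).Reachable (u' 0) (u' i) := by
    intro i
    induction i using Fin.induction with
    | zero => rfl
    | succ i ih =>
      have hmem : e' i.castSucc ∈ {f : E(G) | f.1 ∈ Set.range e ∧ f ≠ g} := by
        refine ⟨⟨_, rfl⟩, fun h => ?_⟩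
        rw [← hlast] at h
        exact (Fin.castSucc_lt_last i).ne (add_right_cancel (hinj (congrArg Subtype.val h)))
      refine ih.trans (spanSimple_reachable_of_isLink hmem ?_)
      have := hl' i.castSucc
      rwa [Fin.coeSucc_eq_succ] at this
  exact key _

lemma IsCycle.connected_erase {C : Set β} (hC : G.IsCycle C) {S : Set E(G)} {g : E(G)}
    (hg : g.1 ∈ C) (hCS : C ⊆ Subtype.val '' S) (hS : (G.spanSimple S).Connected) :
    (G.spanSimple (S \ {g})).Connected := by
  obtain ⟨x, y, hl, hr⟩ := hC.reachable_erase hg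
  refine spanSimple_connected_of_forall_link hS fun f hf => ?_
  by_cases hfg : f = g
  · subst hfg
    refine ⟨x, y, hl, hr.mono (spanSimple_mono ?_)⟩
    rintro f' ⟨hf'C, hf'⟩
    obtain ⟨f'', hf'', h⟩ := hCS hf'C
    exact ⟨Subtype.ext h ▸ hf'', hf'⟩
  · obtain ⟨x', y', hl'⟩ := exists_ends f
    have hmem : f ∈ S \ {g} := ⟨hf, hfg⟩
    exact ⟨x', y', hl', spanSimple_reachable_of_isLink hmem hl'⟩

/-- An edge whose ends are joined by other edges closes a cycle. -/
lemma exists_isCycle_of_reachable {S : Set E(G)} {e : E(G)} (he : e ∉ S) {x y : V(G)}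
    (hl : G.IsLink e.1 x y) (h : (G.spanSimple S).Reachable x y) :
    ∃ C, G.IsCycle C ∧ e.1 ∈ C ∧ C ⊆ Subtype.val '' (insert e S) := by
  obtain ⟨p, hp⟩ := h.exists_isPath
  have hstep : ∀ i < p.length, ∃ f ∈ S, G.IsLink f.1 (p.getVert i) (p.getVert (i + 1)) :=
    fun i hi => (p.adj_getVert_succ hi).2
  have : Nonempty E(G) := ⟨e⟩
  choose! c hc hcl using hstep
  -- The vertices of a path are distinct. An edge used twice in the same direction gives i = j; in
  -- opposite directions it would give i = j + 1 and i + 1 = j.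
  have hinj : ∀ i < p.length, ∀ j < p.length, c i = c j → i = j := by
    intro i hi j hj hij
    have h1 := hcl i hi
    rw [hij] at h1
    have hg := hp.getVert_injOn
    rcases h1.eq_and_eq_or_eq_and_eq (hcl j hj) with ⟨h1, _⟩ | ⟨h1, h2⟩
    · exact hg hi.le hj.le (Subtype.ext h1)
    · have e1 := hg (show i ∈ {i | i ≤ p.length} from hi.le)
        (show j + 1 ∈ {i | i ≤ p.length} from hj) (Subtype.ext h1)
      have e2 := hg (show i + 1 ∈ {i | i ≤ p.length} from hi)
        (show j ∈ {i | i ≤ p.length} from hj.le) (Subtype.ext h2)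
      omega
  let c' : Fin (p.length + 1) → E(G) := fun i => if i.1 < p.length then c i else e
  have hc'S : ∀ i, c' i ∈ insert e S := by
    intro i
    by_cases hi : i.1 < p.length
    · simp only [c', hi, if_true]; exact Or.inr (hc _ hi)
    · simp only [c', hi, if_false]; exact Or.inl rfl
  refine ⟨Set.range fun i => (c' i).1, ⟨p.length, fun i => (c' i).1, fun i => (p.getVert i).1,
    ?_, ?_, rfl⟩, ⟨Fin.last _, by simp [c']⟩, ?_⟩
  · refine Subtype.val_injective.comp fun i j hij => Fin.ext ?_
    by_cases hi : i.1 < p.length <;> by_cases hj : j.1 < p.length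
    · exact hinj _ hi _ hj (by simpa [c', hi, hj] using hij)
    · simp only [c', hi, hj, if_true, if_false] at hij
      exact absurd (hij ▸ hc _ hi) he
    · simp only [c', hi, hj, if_true, if_false] at hij
      exact absurd (hij ▸ hc _ hj) he
    · omega
  · intro i
    by_cases hi : i.1 < p.length
    · have : ((i + 1 : Fin (p.length + 1)) : ℕ) = i + 1 := by
        rw [Fin.val_add_one_of_lt]
        exact Fin.lt_def.2 (by simpa using hi)
      simp only [c', hi, if_true, this]
      exact hcl _ hi
    · obtain rfl : i = Fin.last _ := Fin.ext (by have := i.2; simp; omega)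
      simpa [c', Fin.last_add_one] using hl.symm
  · rintro _ ⟨i, rfl⟩
    exact ⟨c' i, hc'S i, rfl⟩

lemma spanSimple_univ_connected (hG : G.IsConnected) : (G.spanSimple Set.univ).Connected := by
  refine SimpleGraph.Connected.mono (fun u v huv => ?_) hG
  obtain ⟨hne, e, he⟩ := huv
  exact ⟨hne, ⟨e, he.edge_mem⟩, trivial, he⟩

/-- A spanning tree is a connected spanning set of `|V| - 1` edges. -/
theorem isSpanningTree_iff [Fintype E(G)] (hV : V(G).Finite) (hG : G.IsConnected)
    {T : Finset E(G)} :
    G.IsSpanningTree T ↔ T.card + 1 = V(G).ncard ∧ (G.spanSimple T).Connected := by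
  classical
  refine and_congr_right fun hcard => ⟨fun hac => ?_, fun hT C hC hCT => ?_⟩
  -- In a minimal connected superset `T'` of `T`, no edge outside `T` lies on a cycle of `T'`, as it
  -- could be removed. So every cycle of `T'` lies in `T`, and there is none. Hence `T'` equals a
  -- tree inside it, and by cardinality it equals `T`.
  · obtain ⟨T', -, hT'⟩ := Set.Finite.exists_le_minimal
      (s := {T' : Finset E(G) | T ⊆ T' ∧ (G.spanSimple T').Connected}) (Set.toFinite _)
      (a := Finset.univ)
      ⟨Finset.subset_univ T, by simpa using spanSimple_univ_connected hG⟩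
    have hmin : ∀ e ∈ T', e ∉ T → ¬ (G.spanSimple ((T' : Set E(G)) \ {e})).Connected := by
      intro e he heT hcon
      rw [← Finset.coe_erase] at hcon
      have := hT'.2 ⟨Finset.subset_erase.2 ⟨hT'.1.1, heT⟩, hcon⟩ (Finset.erase_subset _ _)
      exact Finset.notMem_erase e T' (this he)
    obtain ⟨T'', hsub, hcon, hcard'⟩ := exists_tree_subset hV hT'.1.2
    have hsub' : T' ⊆ T'' := by
      intro e he
      by_contra heT
      obtain ⟨x, y, hl⟩ := exists_ends e
      obtain ⟨C, hC, heC, hCS⟩ := exists_isCycle_of_reachable heT hl (hcon.preconnected x y)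
      have hCS' := hCS.trans (Set.image_mono (Set.insert_subset he hsub))
      refine hac C hC fun b hb => ?_
      obtain ⟨g, hg, rfl⟩ := hCS' hb
      exact ⟨g, by_contra fun h => hmin g hg h (hC.connected_erase hb hCS' hT'.1.2), rfl⟩
    have : T = T' := Finset.eq_of_subset_of_card_le hT'.1.1 (by
      have := Finset.card_le_card hsub'
      omega)
    exact this ▸ hT'.1.2
  · obtain ⟨b, hb⟩ : C.Nonempty := by
      obtain ⟨k, e, u, -, -, rfl⟩ := hC
      exact Set.range_nonempty e
    obtain ⟨e, he, rfl⟩ := hCT hb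
    have hcon := hC.connected_erase hb hCT hT
    rw [← Finset.coe_erase] at hcon
    -- Dropping an edge of a cycle leaves a connected set with only |V| - 2 edges.
    have h1 := ncard_vertexSet_le_of_connected hcon
    have h2 := Finset.card_erase_add_one (Finset.mem_coe.1 he)
    omega

lemma exists_isSpanningTree_subset [Fintype E(G)] (hV : V(G).Finite) (hG : G.IsConnected)
    {S : Set E(G)} (hS : (G.spanSimple S).Connected) :
    ∃ T : Finset E(G), (T : Set E(G)) ⊆ S ∧ G.IsSpanningTree T := by
  obtain ⟨T, hTS, hT, hcard⟩ := exists_tree_subset hV hS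
  exact ⟨T, hTS, (isSpanningTree_iff hV hG).2 ⟨hcard, hT⟩⟩

/-! ### Exchange properties of spanning trees -/

section Exchange

variable [Fintype E(G)] [DecidableEq E(G)] {T T' : Finset E(G)} {e f : E(G)}

lemma IsSpanningTree.not_connected_erase
    (hT : G.IsSpanningTree T) (hf : f ∈ T) :
    ¬ (G.spanSimple (T.erase f : Finset E(G))).Connected := fun h => by
  have h1 := ncard_vertexSet_le_of_connected h
  have h2 := Finset.card_erase_add_one hf
  have := hT.1
  omega

lemma IsSpanningTree.isSpanningTree_insert_erase_iff (hV : V(G).Finite) (hG : G.IsConnected)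
    (hT : G.IsSpanningTree T) (hf : f ∈ T) :
    G.IsSpanningTree (insert e (T.erase f)) ↔
      (G.spanSimple (insert e (T.erase f : Finset E(G)))).Connected := by
  rw [isSpanningTree_iff hV hG, Finset.coe_insert]
  refine ⟨fun h => h.2, fun h => ⟨?_, h⟩⟩
  have he : e ∉ T.erase f := fun he => by
    rw [← Finset.coe_insert, Finset.insert_eq_of_mem he] at h
    exact hT.not_connected_erase hf h
  rw [Finset.card_insert_of_notMem he, Finset.card_erase_add_one hf]
  exact hT.1

/-- An edge `e` outside a spanning tree whose ends are not joined by `Q` can be exchanged with a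
tree edge whose ends are not joined by `Q` either. -/
lemma IsSpanningTree.exists_exchange (hV : V(G).Finite) (hG : G.IsConnected)
    (hT : G.IsSpanningTree T) {Q : Set E(G)} {a b : V(G)} (hl : G.IsLink e.1 a b)
    (hQ : ¬ (G.spanSimple Q).Reachable a b) :
    ∃ f ∈ T, G.IsSpanningTree (insert e (T.erase f)) ∧
      ∃ x y : V(G), G.IsLink f.1 x y ∧ ¬ (G.spanSimple Q).Reachable x y := by
  have hTc := ((isSpanningTree_iff hV hG).1 hT).2
  -- `P` plays the role of the tree path from a to b: each of its edges is needed to join a and b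
  -- within `P`. As `Q` does not join a and b, it fails to join the ends of some `f` in `P`.
  obtain ⟨P, hPT, hP⟩ := Set.Finite.exists_le_minimal
    (s := {P : Finset E(G) | (G.spanSimple P).Reachable a b}) (Set.toFinite _)
    (hTc.preconnected a b)
  have hex : ∃ f ∈ P, ∃ x y : V(G), G.IsLink f.1 x y ∧ ¬ (G.spanSimple Q).Reachable x y := by
    by_contra! hno
    exact hQ (spanSimple_reachable_of_forall hno hP.1)
  obtain ⟨f, hfP, x, y, hlf, hxy⟩ := hex
  have hfT := hPT hfP
  refine ⟨f, hfT, ?_, x, y, hlf, hxy⟩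
  rw [hT.isSpanningTree_insert_erase_iff hV hG hfT]
  have hPf : ¬ (G.spanSimple (P.erase f : Finset E(G))).Reachable a b := fun h =>
    Finset.notMem_erase f P (hP.2 h (Finset.erase_subset _ _) hfP)
  have hle : G.spanSimple (P.erase f : Finset E(G)) ≤
      G.spanSimple (insert e (T.erase f : Finset E(G))) :=
    spanSimple_mono ((Finset.coe_subset.2 (Finset.erase_subset_erase f hPT)).trans
      (Set.subset_insert _ _))
  have hab : (G.spanSimple (insert e (T.erase f : Finset E(G)))).Reachable a b :=
    spanSimple_reachable_of_isLink (Set.mem_insert _ _) hl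
  have hP1 : (G.spanSimple P).Reachable a b := hP.1
  rw [← Finset.insert_erase hfP, Finset.coe_insert] at hP1
  refine spanSimple_connected_of_forall_link hTc fun g hg => ?_
  by_cases hgf : g = f
  · subst hgf
    refine ⟨x, y, hlf, ?_⟩
    rcases spanSimple_reachable_insert hlf hP1 with h | ⟨h1, h2⟩ | ⟨h1, h2⟩
    · exact absurd h hPf
    · exact (h1.mono hle).symm.trans (hab.trans (h2.mono hle).symm)
    · exact (h2.mono hle).trans (hab.symm.trans (h1.mono hle))
  · obtain ⟨x', y', hl'⟩ := exists_ends g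
    exact ⟨x', y', hl', spanSimple_reachable_of_isLink
      (Or.inr (Finset.mem_coe.2 (Finset.mem_erase.2 ⟨hgf, hg⟩))) hl'⟩

/-- Symmetric exchange of spanning trees. -/
theorem IsSpanningTree.exists_symmetric_exchange (hV : V(G).Finite) (hG : G.IsConnected)
    (hT : G.IsSpanningTree T) (hT' : G.IsSpanningTree T') (he : e ∈ T') :
    ∃ f ∈ T, G.IsSpanningTree (insert e (T.erase f)) ∧ f ∉ T'.erase e ∧
      G.IsSpanningTree (insert f (T'.erase e)) := by
  have hT'c := ((isSpanningTree_iff hV hG).1 hT').2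
  rw [← Finset.insert_erase he, Finset.coe_insert] at hT'c
  obtain ⟨a, b, hl⟩ := exists_ends e
  -- With `Q` equal to T' - e, the edge `f` found in `T` has ends in different components of T' - e,
  -- which is what makes the exchange symmetric.
  have hQ : ¬ (G.spanSimple (T'.erase e : Finset E(G))).Reachable a b := fun h =>
    hT'.not_connected_erase he (spanSimple_connected_of_insert hT'c hl h)
  obtain ⟨f, hf, h1, x, y, hlf, hxy⟩ := hT.exists_exchange hV hG hl hQ
  refine ⟨f, hf, h1, fun h => hxy (spanSimple_reachable_of_isLink h hlf), ?_⟩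
  rw [hT'.isSpanningTree_insert_erase_iff hV hG he]
  exact spanSimple_connected_insert_of_not_reachable hT'c hlf hxy

end Exchange

/-! ### Bonds and their relation to spanning trees -/

section Bond

lemma deleteEdges_toSimpleGraph (F : Set β) :
    (G.deleteEdges F).toSimpleGraph = G.spanSimple {e | e.1 ∉ F} := by
  ext u v
  refine and_congr_right fun _ => ⟨?_, ?_⟩
  · rintro ⟨e, he⟩
    rw [deleteEdges_isLink] at he
    exact ⟨⟨e, he.1.edge_mem⟩, he.2, he.1⟩
  · rintro ⟨e, he, hl⟩
    exact ⟨e.1, by rw [deleteEdges_isLink]; exact ⟨hl, he⟩⟩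

lemma isCutSet_iff (hV : V(G).Finite) (hG : G.IsConnected) {F : Set β} :
    G.IsCutSet F ↔ F ⊆ E(G) ∧ ¬ (G.spanSimple {e | e.1 ∉ F}).Connected := by
  have : Finite V(G) := hV
  have : Nonempty V(G) := hG.nonempty
  refine and_congr_right fun _ => ?_
  have h1 : G.numComponents = 1 := by
    have := hG.preconnected.subsingleton_connectedComponent
    have : Nonempty G.toSimpleGraph.ConnectedComponent :=
      ⟨G.toSimpleGraph.connectedComponentMk (Classical.arbitrary _)⟩
    exact Nat.card_unique
  have h2 : (G.deleteEdges F).numComponents =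
      Nat.card (G.spanSimple {e | e.1 ∉ F}).ConnectedComponent := by
    unfold numComponents
    exact congrArg (fun H : SimpleGraph V(G) => Nat.card H.ConnectedComponent)
      (deleteEdges_toSimpleGraph F)
  rw [h1, h2, Finite.one_lt_card_iff_nontrivial, ← not_subsingleton_iff_nontrivial, not_iff_not]
  refine ⟨fun h => ⟨fun u v => ?_⟩, fun h => h.preconnected.subsingleton_connectedComponent⟩
  exact SimpleGraph.ConnectedComponent.eq.1 (Subsingleton.elim _ _)

variable {e f : E(G)} {F : Set β}

/-- Otherwise `F` without `e` would still be a cut set, against minimality. -/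
lemma IsBond.connected_insert (hV : V(G).Finite) (hG : G.IsConnected) (hF : G.IsBond F)
    (he : e.1 ∈ F) : (G.spanSimple (insert e {g | g.1 ∉ F})).Connected := by
  by_contra hcon
  have hcut : G.IsCutSet (F \ {e.1}) := by
    refine (isCutSet_iff hV hG).2 ⟨Set.sdiff_subset.trans hF.1.1, fun h => hcon ?_⟩
    refine h.mono (spanSimple_mono fun g hg => ?_)
    by_cases hge : g = e
    · exact Or.inl hge
    · exact Or.inr fun hgF => hg ⟨hgF, fun h => hge (Subtype.ext h)⟩
  exact (hF.2 hcut Set.sdiff_subset he).2 rfl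

variable [Fintype E(G)] {T : Finset E(G)}

lemma IsBond.ncard_le (hF : G.IsBond F) : F.ncard ≤ G.maxBondSize := by
  refine le_csSup ⟨E(G).ncard, ?_⟩ ⟨F, hF, rfl⟩
  rintro n ⟨F', hF', rfl⟩
  exact Set.ncard_le_ncard hF'.1.1 (Set.toFinite _)

/-- A nonzero supremum excludes the empty family, for which `sSup` in ℕ takes the default value 0.
-/
lemma exists_isBond_ncard_eq (h : G.maxBondSize ≠ 0) :
    ∃ F, G.IsBond F ∧ F.ncard = G.maxBondSize := by
  refine Nat.sSup_mem (s := {n | ∃ F, G.IsBond F ∧ F.ncard = n}) ?_ ⟨E(G).ncard, ?_⟩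
  · by_contra hne
    rw [Set.not_nonempty_iff_eq_empty] at hne
    exact h (by rw [maxBondSize, hne, csSup_empty]; rfl)
  · rintro n ⟨F', hF', rfl⟩
    exact Set.ncard_le_ncard hF'.1.1 (Set.toFinite _)

/-- The edges that can replace a given edge of a spanning tree form a bond. -/
lemma IsSpanningTree.isBond_exchange [DecidableEq E(G)] (hV : V(G).Finite) (hG : G.IsConnected)
    (hT : G.IsSpanningTree T) (hf : f ∈ T) :
    G.IsBond (Subtype.val '' {e : E(G) | G.IsSpanningTree (insert e (T.erase f))}) := by
  set D : Set E(G) := {e | G.IsSpanningTree (insert e (T.erase f))} with hD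
  have hmemD : ∀ e, e ∈ D ↔ (G.spanSimple (insert e (T.erase f : Finset E(G)))).Connected :=
    fun e => hT.isSpanningTree_insert_erase_iff hV hG hf
  have hnot := hT.not_connected_erase hf
  have hTc := ((isSpanningTree_iff hV hG).1 hT).2
  rw [← Finset.insert_erase hf, Finset.coe_insert] at hTc
  have := hTc.nonempty
  refine ⟨(isCutSet_iff hV hG).2 ⟨?_, fun hcon => hnot ⟨fun u v => ?_⟩⟩, fun F hF hFD => ?_⟩
  · rintro _ ⟨e, -, rfl⟩
    exact e.2
  -- An edge outside `D` has its ends in one component of T - f, so the complement of `D` joins no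
  -- more than T - f does.
  · refine spanSimple_reachable_of_forall (fun e he x y hl => ?_) (hcon.preconnected u v)
    by_contra hxy
    refine he ⟨e, ?_, rfl⟩
    rw [hmemD]
    exact spanSimple_connected_insert_of_not_reachable hTc hl hxy
  -- If a cut set inside `D` missed `e`, its complement would contain `e` and all of T - f (which is
  -- disjoint from `D`), hence be connected.
  · rintro _ ⟨e, he, rfl⟩
    by_contra heF
    rw [isCutSet_iff hV hG] at hF
    refine hF.2 (((hmemD e).1 he).mono (spanSimple_mono ?_))
    rintro g (rfl | hg)
    · exact heF
    · intro hgF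
      obtain ⟨g', hg', h⟩ := hFD hgF
      rw [Subtype.ext h, hmemD, Set.insert_eq_of_mem hg] at hg'
      exact hnot hg'

lemma IsSpanningTree.card_exchange_le [DecidableEq E(G)]
    [DecidablePred fun e : E(G) => G.IsSpanningTree (insert e (T.erase f))] (hV : V(G).Finite)
    (hG : G.IsConnected) (hT : G.IsSpanningTree T) (hf : f ∈ T) :
    (Finset.univ.filter fun e : E(G) => G.IsSpanningTree (insert e (T.erase f))).card ≤
      G.maxBondSize := by
  have h := (hT.isBond_exchange hV hG hf).ncard_le
  rw [Set.ncard_image_of_injective _ Subtype.val_injective] at h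
  rw [← Set.ncard_coe_finset]
  simpa using h

/-- Each edge of a bond is the only bond edge of some spanning tree. -/
lemma IsBond.exists_isSpanningTree (hV : V(G).Finite) (hG : G.IsConnected) (hF : G.IsBond F)
    (he : e.1 ∈ F) : ∃ T : Finset E(G), G.IsSpanningTree T ∧ ∀ g ∈ T, g.1 ∈ F → g = e := by
  obtain ⟨T, hTS, hT⟩ := exists_isSpanningTree_subset hV hG (hF.connected_insert hV hG he)
  exact ⟨T, hT, fun g hg hgF => (hTS hg).resolve_right fun h => h hgF⟩

/-- A bond edge can be exchanged with a bond edge of any spanning tree. -/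
lemma IsBond.exists_exchange [DecidableEq E(G)] (hV : V(G).Finite) (hG : G.IsConnected)
    (hF : G.IsBond F) (he : e.1 ∈ F) (hT : G.IsSpanningTree T) :
    ∃ f ∈ T, f.1 ∈ F ∧ G.IsSpanningTree (insert e (T.erase f)) := by
  obtain ⟨a, b, hl⟩ := exists_ends e
  have hQ : ¬ (G.spanSimple {g | g.1 ∉ F}).Reachable a b := fun h =>
    ((isCutSet_iff hV hG).1 hF.1).2
      (spanSimple_connected_of_insert (hF.connected_insert hV hG he) hl h)
  obtain ⟨f, hf, h1, x, y, hlf, hxy⟩ := hT.exists_exchange hV hG hl hQ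
  exact ⟨f, hf, by_contra fun h => hxy (spanSimple_reachable_of_isLink h hlf), h1⟩

end Bond

end Graph

/-! ### The exponential law: tails, truncated mean, mean -/

section Exponential

open Set

variable {r : ℝ}

lemma expMeasure_Ioi (hr : 0 < r) {t : ℝ} (ht : 0 ≤ t) :
    expMeasure r (Ioi t) = ENNReal.ofReal (Real.exp (-(r * t))) := by
  have := isProbabilityMeasure_expMeasure hr
  have h1 := cdf_expMeasure_eq hr t
  rw [if_pos ht, cdf_eq_real] at h1
  rw [← compl_Iic, ← ofReal_measureReal, probReal_compl_eq_one_sub measurableSet_Iic, h1,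
    sub_sub_cancel]

lemma expMeasure_eq_withDensity (r : ℝ) :
    expMeasure r = volume.withDensity (exponentialPDF r) := rfl

instance nullSingletonClass_expMeasure : NullSingletonClass (expMeasure r) := by
  rw [expMeasure_eq_withDensity]
  infer_instance

/-- The constant hazard rate: the density at t ≥ 0 is r times the tail beyond t. This is the only
property special to the exponential law behind the formula for the cost. -/
lemma expMeasure_eq_lintegral_Ioi (hr : 0 < r) {S : Set ℝ} (hS : MeasurableSet S) :
    expMeasure r S =
      ENNReal.ofReal r * ∫⁻ t in Ioi 0, S.indicator (fun t => expMeasure r (Ioi t)) t := by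
  rw [expMeasure_eq_withDensity, withDensity_apply _ hS, ← lintegral_indicator hS,
    ← lintegral_const_mul' _ _ ENNReal.ofReal_ne_top, ← expMeasure_eq_withDensity,
    ← lintegral_add_compl _ (measurableSet_Ioi (a := (0 : ℝ))), compl_Ioi,
    ← setLIntegral_congr Iio_ae_eq_Iic, setLIntegral_eq_zero measurableSet_Iio, add_zero]
  · refine setLIntegral_congr_fun measurableSet_Ioi fun t ht => ?_
    have ht' : (0 : ℝ) ≤ t := le_of_lt ht
    by_cases hts : t ∈ S
    · simp only [indicator_of_mem hts]
      rw [exponentialPDF_of_nonneg ht', expMeasure_Ioi hr ht', ENNReal.ofReal_mul hr.le]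
    · simp only [indicator_of_notMem hts, mul_zero]
  · intro t ht
    by_cases hts : t ∈ S
    · simp [hts, exponentialPDF_of_neg ht]
    · simp [hts]

lemma ae_nonneg_expMeasure (r : ℝ) : ∀ᵐ x ∂(expMeasure r), 0 ≤ x := by
  rw [ae_iff, expMeasure_eq_withDensity]
  simp only [not_le]
  change (volume.withDensity (exponentialPDF r)) (Iio 0) = 0
  rw [withDensity_apply _ measurableSet_Iio, lintegral_exponentialPDF_of_nonpos le_rfl]

/-- Capping an exponential variable at `c`. -/
lemma expMeasure_Iio (hr : 0 < r) (c : ℝ) :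
    expMeasure r (Iio c) =
      ENNReal.ofReal r * ∫⁻ x, ENNReal.ofReal (min x c - min 0 c) ∂(expMeasure r) := by
  -- Layer-cake formula: for t > 0 the truncated variable exceeds t with the probability that x > t
  -- if t < c, and never otherwise. Subtracting `min 0 c` covers negative c, where both sides
  -- vanish.
  rw [expMeasure_eq_lintegral_Ioi hr measurableSet_Iio, lintegral_eq_lintegral_meas_lt]
  · congr 1
    refine setLIntegral_congr_fun measurableSet_Ioi fun t ht => ?_
    have ht' : (0 : ℝ) < t := ht
    by_cases htc : t < c
    · rw [indicator_of_mem (show t ∈ Iio c from htc)]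
      congr 1
      ext x
      simp only [mem_Ioi, mem_ofPred_eq, min_eq_left (ht'.trans htc).le, sub_zero, lt_min_iff]
      tauto
    · rw [indicator_of_notMem (show t ∉ Iio c from htc)]
      symm
      convert! measure_empty (μ := expMeasure r)
      ext x
      simp only [mem_ofPred_eq, mem_empty_iff_false, iff_false, not_lt]
      grind
  · filter_upwards [ae_nonneg_expMeasure r] with x hx
    simp only [Pi.zero_apply, sub_nonneg]
    exact min_le_min_right c hx
  · fun_prop

lemma lintegral_id_expMeasure (hr : 0 < r) :
    ENNReal.ofReal r * ∫⁻ x, ENNReal.ofReal x ∂(expMeasure r) = 1 := by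
  have := isProbabilityMeasure_expMeasure hr
  rw [lintegral_eq_lintegral_meas_lt _ (ae_nonneg_expMeasure r) aemeasurable_id']
  have := expMeasure_eq_lintegral_Ioi hr MeasurableSet.univ
  rw [measure_univ] at this
  simpa [Ioi] using this.symm

lemma lintegral_id_expMeasure' (hr : 0 < r) :
    ∫⁻ x, ENNReal.ofReal x ∂(expMeasure r) = ENNReal.ofReal r⁻¹ := by
  rw [ENNReal.ofReal_inv_of_pos hr]
  exact ENNReal.eq_inv_of_mul_eq_one_left (by rw [mul_comm]; exact lintegral_id_expMeasure hr)

lemma integrable_id_expMeasure (hr : 0 < r) : Integrable (fun x : ℝ => x) (expMeasure r) := by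
  refine ⟨by fun_prop, ?_⟩
  rw [hasFiniteIntegral_iff_ofReal (ae_nonneg_expMeasure r), lintegral_id_expMeasure' hr]
  exact ENNReal.ofReal_lt_top

lemma integral_id_expMeasure (hr : 0 < r) : ∫ x, x ∂(expMeasure r) = r⁻¹ := by
  rw [integral_eq_lintegral_of_nonneg_ae (ae_nonneg_expMeasure r) (by fun_prop),
    lintegral_id_expMeasure' hr, ENNReal.toReal_ofReal (inv_nonneg.2 hr.le)]

end Exponential

/-! ### Fubini for a product law, one coordinate at a time -/

section Resampling

variable {ι : Type*} [Fintype ι] [DecidableEq ι] (μ : ι → Measure ℝ)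
  [∀ i, IsProbabilityMeasure (μ i)]

/-- Resampling one coordinate does not change a product law. -/
lemma map_update_pi (e : ι) :
    ((Measure.pi μ).prod (μ e)).map (fun p => Function.update p.1 e p.2) = Measure.pi μ := by
  refine (Measure.pi_eq fun s hs => ?_).symm
  rw [Measure.map_apply measurable_update' (.univ_pi hs)]
  have : (fun p : (ι → ℝ) × ℝ => Function.update p.1 e p.2) ⁻¹' Set.univ.pi s =
      (Set.univ.pi (Function.update s e Set.univ)) ×ˢ s e := by
    ext p
    simp only [Set.mem_preimage, Set.mem_pi, Set.mem_univ, true_imp_iff, Set.mem_prod]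
    constructor
    · intro h
      refine ⟨fun i => ?_, by simpa using h e⟩
      by_cases hi : i = e
      · subst hi; simp
      · simpa [hi] using h i
    · rintro ⟨h1, h2⟩ i
      by_cases hi : i = e
      · subst hi; simpa using h2
      · simpa [hi] using h1 i
  rw [this, Measure.prod_prod, Measure.pi_pi, ← Finset.mul_prod_erase _ _ (Finset.mem_univ e),
    ← Finset.mul_prod_erase (Finset.univ) (fun i => μ i (s i)) (Finset.mem_univ e), mul_comm]
  congr 1
  simp only [Function.update_self, measure_univ, one_mul]
  refine Finset.prod_congr rfl fun i hi => ?_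
  rw [Function.update_of_ne (Finset.ne_of_mem_erase hi)]

lemma lintegral_pi_update (e : ι) {F : (ι → ℝ) → ENNReal} (hF : Measurable F) :
    ∫⁻ s, F s ∂(Measure.pi μ) =
      ∫⁻ s, ∫⁻ x, F (Function.update s e x) ∂(μ e) ∂(Measure.pi μ) := by
  conv_lhs => rw [← map_update_pi μ e]
  rw [lintegral_map hF measurable_update']
  exact lintegral_prod _ (hF.comp measurable_update').aemeasurable

lemma measure_pi_update (e : ι) {S : Set (ι → ℝ)} (hS : MeasurableSet S) :
    Measure.pi μ S = ∫⁻ s, μ e {x | Function.update s e x ∈ S} ∂(Measure.pi μ) := by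
  rw [← lintegral_indicator_one hS, lintegral_pi_update μ e (measurable_one.indicator hS)]
  refine lintegral_congr fun s => ?_
  have : MeasurableSet {x | Function.update s e x ∈ S} :=
    hS.preimage (measurable_update s)
  rw [← lintegral_indicator_one this]
  rfl

end Resampling

/-! ### Independent exponential variables and their minimum -/

section ProductExponential

variable {ι : Type*} [Fintype ι] {r : ι → ℝ}

lemma integrable_eval_expMeasure (hr : ∀ i, 0 < r i) (e : ι) :
    Integrable (fun s : ι → ℝ => s e) (Measure.pi fun i => expMeasure (r i)) := by
  have : ∀ i, IsProbabilityMeasure (expMeasure (r i)) :=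
    fun i => isProbabilityMeasure_expMeasure (hr i)
  exact integrable_comp_eval (μ := fun i => expMeasure (r i)) (i := e) (f := fun x : ℝ => x)
    (integrable_id_expMeasure (hr e))

lemma integral_eval_expMeasure (hr : ∀ i, 0 < r i) (e : ι) :
    ∫ s : ι → ℝ, s e ∂(Measure.pi fun i => expMeasure (r i)) = (r e)⁻¹ := by
  have : ∀ i, IsProbabilityMeasure (expMeasure (r i)) :=
    fun i => isProbabilityMeasure_expMeasure (hr i)
  rw [integral_comp_eval (μ := fun i => expMeasure (r i)) (i := e) (f := fun x : ℝ => x)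
    (by fun_prop),
    integral_id_expMeasure (hr e)]

lemma ae_nonneg_pi_expMeasure (hr : ∀ i, 0 < r i) :
    ∀ᵐ s : ι → ℝ ∂(Measure.pi fun i => expMeasure (r i)), ∀ i, 0 ≤ s i := by
  have : ∀ i, IsProbabilityMeasure (expMeasure (r i)) :=
    fun i => isProbabilityMeasure_expMeasure (hr i)
  exact ae_all_iff.2 fun i =>
    (measurePreserving_eval (fun i => expMeasure (r i)) i).quasiMeasurePreserving.ae
    (ae_nonneg_expMeasure (r i))

/-- The minimum of independent exponential variables is exponential with the total rate. -/
lemma integral_inf'_expMeasure (hr : ∀ i, 0 < r i) {F : Finset ι} (hF : F.Nonempty) :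
    Integrable (fun s : ι → ℝ => F.inf' hF s) (Measure.pi fun i => expMeasure (r i)) ∧
    ∫ s : ι → ℝ, F.inf' hF s ∂(Measure.pi fun i => expMeasure (r i)) = (∑ i ∈ F, r i)⁻¹ := by
  classical
  have : ∀ i, IsProbabilityMeasure (expMeasure (r i)) :=
    fun i => isProbabilityMeasure_expMeasure (hr i)
  have hR : 0 < ∑ i ∈ F, r i := Finset.sum_pos (fun i _ => hr i) hF
  have hc : Continuous fun s : ι → ℝ => F.inf' hF s :=
    Continuous.finset_inf'_apply (f := fun i (s : ι → ℝ) => s i) _ fun _ _ => by fun_prop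
  have hnn : 0 ≤ᵐ[Measure.pi fun i => expMeasure (r i)] fun s : ι → ℝ => F.inf' hF s := by
    filter_upwards [ae_nonneg_pi_expMeasure hr] with s hs
    exact Finset.le_inf' _ _ fun i _ => hs i
  have key : ∫⁻ s : ι → ℝ, ENNReal.ofReal (F.inf' hF s) ∂(Measure.pi fun i => expMeasure (r i)) =
      ENNReal.ofReal (∑ i ∈ F, r i)⁻¹ := by
    -- By the layer-cake formula it suffices to compare tails: that of the minimum is the product of
    -- the tails over `F`.
    rw [← lintegral_id_expMeasure' hR, lintegral_eq_lintegral_meas_lt _ hnn hc.aemeasurable,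
      lintegral_eq_lintegral_meas_lt _ (ae_nonneg_expMeasure _) aemeasurable_id']
    refine setLIntegral_congr_fun measurableSet_Ioi fun t ht => ?_
    have ht' : (0 : ℝ) ≤ t := le_of_lt ht
    have hset : {s : ι → ℝ | t < F.inf' hF s} =
        Set.univ.pi fun i => if i ∈ F then Set.Ioi t else Set.univ := by
      ext s
      simp only [Set.mem_ofPred_eq, Finset.lt_inf'_iff, Set.mem_pi, Set.mem_univ, true_imp_iff]
      refine forall_congr' fun i => ?_
      by_cases hi : i ∈ F <;> simp [hi]
    have hfac : ∀ i, expMeasure (r i) (if i ∈ F then Set.Ioi t else Set.univ) =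
        if i ∈ F then ENNReal.ofReal (Real.exp (-(r i * t))) else 1 := fun i => by
      by_cases hi : i ∈ F
      · simp [hi, expMeasure_Ioi (hr i) ht']
      · simp [hi]
    change _ = expMeasure _ (Set.Ioi t)
    rw [hset, Measure.pi_pi, expMeasure_Ioi hR ht']
    simp only [hfac]
    rw [Finset.prod_ite_mem, Finset.univ_inter, ← ENNReal.ofReal_prod_of_nonneg
      fun i _ => (Real.exp_pos _).le, ← Real.exp_sum, Finset.sum_neg_distrib, Finset.sum_mul]
  constructor
  · refine ⟨hc.measurable.aestronglyMeasurable, ?_⟩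
    rw [hasFiniteIntegral_iff_ofReal hnn, key]
    exact ENNReal.ofReal_lt_top
  · rw [integral_eq_lintegral_of_nonneg_ae hnn hc.measurable.aestronglyMeasurable, key,
      ENNReal.toReal_ofReal (inv_nonneg.2 hR.le)]

end ProductExponential

/-! ### Minimum weight over a family of sets: selection probability and contribution -/

section Optimization

variable {ι : Type*} (𝓕 : Finset (Finset ι)) (h𝓕 : 𝓕.Nonempty)

/-- The minimum weight of a member of a family of sets. -/
def minWeight (s : ι → ℝ) : ℝ := 𝓕.inf' h𝓕 fun T => ∑ i ∈ T, s i

variable {𝓕 h𝓕}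

lemma minWeight_le (s : ι → ℝ) {T : Finset ι} (hT : T ∈ 𝓕) : minWeight 𝓕 h𝓕 s ≤ ∑ i ∈ T, s i :=
  Finset.inf'_le _ hT

lemma exists_minWeight_eq (s : ι → ℝ) : ∃ T ∈ 𝓕, minWeight 𝓕 h𝓕 s = ∑ i ∈ T, s i :=
  Finset.exists_mem_eq_inf' _ _

lemma minWeight_nonneg {s : ι → ℝ} (hs : ∀ i, 0 ≤ s i) : 0 ≤ minWeight 𝓕 h𝓕 s :=
  Finset.le_inf' _ _ fun _ _ => Finset.sum_nonneg fun i _ => hs i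

variable (𝓕 h𝓕) in
lemma continuous_minWeight : Continuous (minWeight 𝓕 h𝓕) :=
  Continuous.finset_inf'_apply _ fun _ _ => by fun_prop

lemma minWeight_mono {s s' : ι → ℝ} (h : s ≤ s') : minWeight 𝓕 h𝓕 s ≤ minWeight 𝓕 h𝓕 s' :=
  Finset.le_inf' _ _ fun _ hT => (minWeight_le s hT).trans (Finset.sum_le_sum fun i _ => h i)

variable [DecidableEq ι]

variable (𝓕 h𝓕) in
/-- The decrease of the minimum weight when the weight of `e` is set to zero. -/
def contribution (e : ι) (s : ι → ℝ) : ℝ :=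
  minWeight 𝓕 h𝓕 s - minWeight 𝓕 h𝓕 (Function.update s e 0)

variable (𝓕 h𝓕) in
lemma continuous_contribution (e : ι) : Continuous (contribution 𝓕 h𝓕 e) :=
  (continuous_minWeight 𝓕 h𝓕).sub
    ((continuous_minWeight 𝓕 h𝓕).comp (continuous_id.update e continuous_const))

lemma contribution_nonneg {e : ι} {s : ι → ℝ} (hs : 0 ≤ s e) : 0 ≤ contribution 𝓕 h𝓕 e s :=
  sub_nonneg.2 (minWeight_mono (update_le_self_iff.2 hs))

lemma sum_update_of_mem {e : ι} {T : Finset ι} (he : e ∈ T) (s : ι → ℝ) (x : ℝ) :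
    ∑ i ∈ T, Function.update s e x i = x + ∑ i ∈ T.erase e, s i := by
  rw [Finset.sum_update_of_mem he, Finset.sdiff_singleton_eq_erase]

/-- A set optimal after zeroing `e` costs at most `s e` more under `s`. -/
lemma contribution_le {e : ι} {s : ι → ℝ} (hs : 0 ≤ s e) : contribution 𝓕 h𝓕 e s ≤ s e := by
  obtain ⟨T, hT, h⟩ := exists_minWeight_eq (h𝓕 := h𝓕) (Function.update s e 0)
  have h1 := minWeight_le (h𝓕 := h𝓕) s hT
  rw [contribution, h]
  by_cases he : e ∈ T
  · rw [sum_update_of_mem he]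
    rw [← Finset.add_sum_erase _ _ he] at h1
    linarith
  · rw [Finset.sum_update_of_notMem he]
    linarith

variable [Fintype ι] {r : ι → ℝ} {A : (ι → ℝ) → Finset ι}

/-- The probability that an optimal set contains `e`, in terms of the contribution of `e` to the
minimum weight, for independent exponential weights. -/
theorem measure_mem_optimal (hr : ∀ i, 0 < r i) (hA : ∀ s, A s ∈ 𝓕)
    (hAmin : ∀ s, ∑ i ∈ A s, s i = minWeight 𝓕 h𝓕 s) (e : ι) :
    NullMeasurableSet {s | e ∈ A s} (Measure.pi fun i => expMeasure (r i)) ∧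
      (Measure.pi fun i => expMeasure (r i)) {s | e ∈ A s} =
        ENNReal.ofReal (r e) * ∫⁻ s, ENNReal.ofReal (contribution 𝓕 h𝓕 e s)
          ∂(Measure.pi fun i => expMeasure (r i)) := by
  have : ∀ i, IsProbabilityMeasure (expMeasure (r i)) :=
    fun i => isProbabilityMeasure_expMeasure (hr i)
  set μ := fun i => expMeasure (r i) with hμ
  -- The minima a and b below need members with and without `e`. If no member contains `e`, both
  -- sides are 0.
  by_cases hin : (𝓕.filter fun T => e ∈ T).Nonempty
  swap
  · have hno : ∀ T ∈ 𝓕, e ∉ T := fun T hT he => hin ⟨T, Finset.mem_filter.2 ⟨hT, he⟩⟩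
    have h1 : {s | e ∈ A s} = ∅ := Set.eq_empty_of_forall_notMem fun s => hno _ (hA s)
    have h2 : ∀ s, contribution 𝓕 h𝓕 e s = 0 := fun s => by
      refine sub_eq_zero.2 (Finset.inf'_congr _ rfl fun T hT => ?_)
      rw [Finset.sum_update_of_notMem (hno T hT)]
    simp [h1, h2]
  set a : (ι → ℝ) → ℝ := fun s => (𝓕.filter fun T => e ∈ T).inf' hin fun T => ∑ i ∈ T.erase e, s i
    with ha
  have ha_le : ∀ s, ∀ T ∈ 𝓕, e ∈ T → s e + a s ≤ ∑ i ∈ T, s i := fun s T hT he => by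
    rw [← Finset.add_sum_erase _ _ he]
    have hmem : T ∈ 𝓕.filter fun T => e ∈ T := Finset.mem_filter.2 ⟨hT, he⟩
    exact add_le_add_right (Finset.inf'_le (fun T => ∑ i ∈ T.erase e, s i) hmem) _
  have ha_ex : ∀ s, ∃ T ∈ 𝓕, e ∈ T ∧ ∑ i ∈ T, s i = s e + a s := fun s => by
    obtain ⟨T, hT, h⟩ := Finset.exists_mem_eq_inf' hin fun T => ∑ i ∈ T.erase e, s i
    obtain ⟨hT, he⟩ := Finset.mem_filter.1 hT
    exact ⟨T, hT, he, by rw [← Finset.add_sum_erase _ _ he, ha]; simp only [h]⟩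
  have ha_upd : ∀ s x, a (Function.update s e x) = a s := fun s x =>
    Finset.inf'_congr _ rfl fun T _ => Finset.sum_congr rfl fun i hi =>
      Function.update_of_ne (Finset.ne_of_mem_erase hi) _ _
  have ha_cont : Continuous a := Continuous.finset_inf'_apply _ fun _ _ => by fun_prop
  have hcm := (continuous_contribution 𝓕 h𝓕 e).measurable
  -- If every member contains `e`, the probability is 1 and the contribution is `s e`, of mean 1 / r
  -- e.
  by_cases hout : (𝓕.filter fun T => e ∉ T).Nonempty
  swap
  · have hall : ∀ T ∈ 𝓕, e ∈ T := fun T hT => by_contra fun he =>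
      hout ⟨T, Finset.mem_filter.2 ⟨hT, he⟩⟩
    have h1 : {s | e ∈ A s} = Set.univ := Set.eq_univ_of_forall fun s => hall _ (hA s)
    have hmin : ∀ s, minWeight 𝓕 h𝓕 s = s e + a s := fun s => by
      obtain ⟨T, hT, h⟩ := exists_minWeight_eq (h𝓕 := h𝓕) s
      obtain ⟨T', hT', -, h'⟩ := ha_ex s
      exact le_antisymm (h' ▸ minWeight_le s hT') (h ▸ ha_le s T hT (hall T hT))
    have h2 : ∀ s, contribution 𝓕 h𝓕 e s = s e := fun s => by
      rw [contribution, hmin, hmin, ha_upd, Function.update_self]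
      ring
    simp only [h1, h2]
    refine ⟨MeasurableSet.univ.nullMeasurableSet, ?_⟩
    rw [(measurePreserving_eval μ e).lintegral_comp
      (f := fun x => ENNReal.ofReal x) ENNReal.measurable_ofReal, measure_univ]
    exact (lintegral_id_expMeasure (hr e)).symm
  set b : (ι → ℝ) → ℝ := fun s => (𝓕.filter fun T => e ∉ T).inf' hout fun T => ∑ i ∈ T, s i with hb
  have hb_le : ∀ s, ∀ T ∈ 𝓕, e ∉ T → b s ≤ ∑ i ∈ T, s i := fun s T hT he =>
    Finset.inf'_le (fun T => ∑ i ∈ T, s i) (Finset.mem_filter.2 ⟨hT, he⟩)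
  have hb_ex : ∀ s, ∃ T ∈ 𝓕, e ∉ T ∧ ∑ i ∈ T, s i = b s := fun s => by
    obtain ⟨T, hT, h⟩ := Finset.exists_mem_eq_inf' hout fun T => ∑ i ∈ T, s i
    obtain ⟨hT, he⟩ := Finset.mem_filter.1 hT
    exact ⟨T, hT, he, h.symm⟩
  have hb_upd : ∀ s x, b (Function.update s e x) = b s := fun s x =>
    Finset.inf'_congr _ rfl fun T hT => by
      rw [Finset.sum_update_of_notMem (Finset.mem_filter.1 hT).2]
  have hb_cont : Continuous b := Continuous.finset_inf'_apply _ fun _ _ => by fun_prop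
  have hmin : ∀ s, minWeight 𝓕 h𝓕 s = min (s e + a s) (b s) := fun s => by
    obtain ⟨T, hT, h⟩ := exists_minWeight_eq (h𝓕 := h𝓕) s
    obtain ⟨T₁, hT₁, -, h₁⟩ := ha_ex s
    obtain ⟨T₂, hT₂, -, h₂⟩ := hb_ex s
    refine le_antisymm (le_min (h₁ ▸ minWeight_le s hT₁) (h₂ ▸ minWeight_le s hT₂)) ?_
    rw [h, min_le_iff]
    by_cases he : e ∈ T
    · exact Or.inl (ha_le s T hT he)
    · exact Or.inr (hb_le s T hT he)
  have hcontr : ∀ s x, contribution 𝓕 h𝓕 e (Function.update s e x) =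
      min x (b s - a s) - min 0 (b s - a s) := fun s x => by
    rw [contribution, Function.update_idem, hmin, hmin, ha_upd, ha_upd, hb_upd, hb_upd,
      Function.update_self, Function.update_self]
    have : ∀ y, min (y + a s) (b s) = min y (b s - a s) + a s := fun y => by
      rw [← min_add_add_right, sub_add_cancel]
    rw [this, this]
    ring
  have hlt : MeasurableSet {s : ι → ℝ | s e + a s < b s} :=
    measurableSet_lt ((measurable_pi_apply e).add ha_cont.measurable) hb_cont.measurable
  have heq : MeasurableSet {s : ι → ℝ | s e + a s = b s} :=
    measurableSet_eq_fun ((measurable_pi_apply e).add ha_cont.measurable) hb_cont.measurable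
  -- Given the other coordinates, a tie occurs for a single value of `s e`, which is null for an
  -- atomless law.
  have hnull : Measure.pi μ {s : ι → ℝ | s e + a s = b s} = 0 := by
    rw [measure_pi_update μ e heq]
    rw [← lintegral_zero (μ := Measure.pi μ)]
    refine lintegral_congr fun s => ?_
    have : {x | Function.update s e x ∈ {s : ι → ℝ | s e + a s = b s}} = {b s - a s} := by
      ext x
      simp only [Set.mem_ofPred_eq, ha_upd, hb_upd, Function.update_self, Set.mem_singleton_iff,
        eq_sub_iff_add_eq]
    rw [this]
    exact measure_singleton _
  -- Off ties the tie-breaking rule has no influence; this yields null-measurability although `A`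
  -- itself is not assumed measurable.
  have hae : {s | e ∈ A s} =ᵐ[Measure.pi μ] {s : ι → ℝ | s e + a s < b s} := by
    have hne : ∀ᵐ s ∂(Measure.pi μ), s e + a s ≠ b s := by
      rw [ae_iff]; simpa using hnull
    filter_upwards [hne] with s hs
    refine propext ⟨fun he => lt_of_le_of_ne ?_ hs, fun h => ?_⟩
    · refine (ha_le s _ (hA s) he).trans ?_
      rw [hAmin, hmin]
      exact min_le_right _ _
    · by_contra he
      refine (hb_le s _ (hA s) he).not_gt ?_
      rw [hAmin, hmin]
      exact (min_le_left _ _).trans_lt h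
  refine ⟨hlt.nullMeasurableSet.congr hae.symm, ?_⟩
  rw [measure_congr hae, measure_pi_update μ e hlt, lintegral_pi_update μ e hcm.ennreal_ofReal,
    ← lintegral_const_mul' _ _ ENNReal.ofReal_ne_top]
  refine lintegral_congr fun s => ?_
  have : {x | Function.update s e x ∈ {s : ι → ℝ | s e + a s < b s}} = Set.Iio (b s - a s) := by
    ext x
    simp only [Set.mem_ofPred_eq, ha_upd, hb_upd, Function.update_self, Set.mem_Iio,
      lt_sub_iff_add_lt]
  rw [this, hμ, expMeasure_Iio (hr e)]
  simp only [hcontr]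

lemma integrable_contribution (hr : ∀ i, 0 < r i) (e : ι) :
    Integrable (contribution 𝓕 h𝓕 e) (Measure.pi fun i => expMeasure (r i)) := by
  refine (integrable_eval_expMeasure hr e).mono'
    (continuous_contribution 𝓕 h𝓕 e).measurable.aestronglyMeasurable ?_
  filter_upwards [ae_nonneg_pi_expMeasure hr] with s hs
  rw [Real.norm_of_nonneg (contribution_nonneg (hs e))]
  exact contribution_le (hs e)

lemma measureReal_mem_optimal (hr : ∀ i, 0 < r i) (hA : ∀ s, A s ∈ 𝓕)
    (hAmin : ∀ s, ∑ i ∈ A s, s i = minWeight 𝓕 h𝓕 s) (e : ι) :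
    (Measure.pi fun i => expMeasure (r i)).real {s | e ∈ A s} * (r e)⁻¹ =
      ∫ s, contribution 𝓕 h𝓕 e s ∂(Measure.pi fun i => expMeasure (r i)) := by
  have hnn : 0 ≤ᵐ[Measure.pi fun i => expMeasure (r i)] contribution 𝓕 h𝓕 e := by
    filter_upwards [ae_nonneg_pi_expMeasure hr] with s hs using contribution_nonneg (hs e)
  rw [measureReal_def, (measure_mem_optimal hr hA hAmin e).2, ENNReal.toReal_mul,
    ENNReal.toReal_ofReal (hr e).le, integral_eq_lintegral_of_nonneg_ae hnn
      (continuous_contribution 𝓕 h𝓕 e).measurable.aestronglyMeasurable]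
  field_simp [(hr e).ne']

end Optimization

/-! ### Contributions of edges to the minimum spanning tree weight -/

namespace Graph

variable {α β : Type*} {G : Graph α β} [Fintype E(G)]

open Classical in
/-- The family of spanning trees. -/
def spanningTrees (G : Graph α β) [Fintype E(G)] : Finset (Finset E(G)) :=
  Finset.univ.filter G.IsSpanningTree

lemma mem_spanningTrees {T : Finset E(G)} : T ∈ G.spanningTrees ↔ G.IsSpanningTree T := by
  simp [spanningTrees]

section Contribution

variable {h𝓕 : G.spanningTrees.Nonempty} {s : E(G) → ℝ}

-- Take T' optimal after zeroing `e`. If T' contains `e`, symmetric exchange gives f in T with T - f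
-- + e and T' - e + f both spanning trees; comparing the minimum under `s` with T' - e + f bounds
-- the contribution by `s f`. If T' avoids `e`, the contribution is at most 0.
open Classical in
lemma exists_contribution_le (hV : V(G).Finite) (hG : G.IsConnected) (hs : ∀ e, 0 ≤ s e)
    {T : Finset E(G)} (hT : G.IsSpanningTree T) (e : E(G)) :
    contribution G.spanningTrees h𝓕 e s ≤
      ∑ f ∈ T, if G.IsSpanningTree (insert e (T.erase f)) then s f else 0 := by
  have hnn : ∀ f ∈ T, 0 ≤ if G.IsSpanningTree (insert e (T.erase f)) then s f else 0 :=
    fun f _ => by split_ifs <;> simp [hs f]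
  obtain ⟨T', hT', h⟩ := exists_minWeight_eq (h𝓕 := h𝓕) (Function.update s e 0)
  by_cases he : e ∈ T'
  · obtain ⟨f, hf, h1, hfT', h2⟩ :=
      hT.exists_symmetric_exchange hV hG (mem_spanningTrees.1 hT') he
    refine le_trans ?_ (Finset.single_le_sum hnn hf)
    rw [if_pos h1, contribution, h, sum_update_of_mem he]
    have := minWeight_le (h𝓕 := h𝓕) s (mem_spanningTrees.2 h2)
    rw [Finset.sum_insert hfT'] at this
    linarith
  · refine le_trans ?_ (Finset.sum_nonneg hnn)
    rw [contribution, h, Finset.sum_update_of_notMem he]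
    exact sub_nonpos.2 (minWeight_le s hT')

-- Charge each edge to a minimum spanning tree T and swap the sums: every f in T is charged by at
-- most as many edges as a bond can have.
open Classical in
lemma sum_contribution_le (hV : V(G).Finite) (hG : G.IsConnected) (hs : ∀ e, 0 ≤ s e) :
    ∑ e, contribution G.spanningTrees h𝓕 e s ≤
      G.maxBondSize * minWeight G.spanningTrees h𝓕 s := by
  obtain ⟨T, hT, hTmin⟩ := exists_minWeight_eq (h𝓕 := h𝓕) s
  have hT' := mem_spanningTrees.1 hT
  refine (Finset.sum_le_sum fun e _ => exists_contribution_le hV hG hs hT' e).trans ?_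
  rw [Finset.sum_comm, hTmin, Finset.mul_sum]
  refine Finset.sum_le_sum fun f hf => ?_
  rw [← Finset.sum_filter, Finset.sum_const, nsmul_eq_mul]
  exact mul_le_mul_of_nonneg_right (Nat.cast_le.2 (hT'.card_exchange_le hV hG hf)) (hs f)

-- A minimum spanning tree T has a bond edge f for which T - f + e is a spanning tree. Once `e` is
-- free this tree saves `s f`, which is at least the minimum over the bond.
open Classical in
lemma le_contribution (hV : V(G).Finite) (hG : G.IsConnected) {F : Finset E(G)}
    (hF : G.IsBond (Subtype.val '' (F : Set E(G)))) (hFne : F.Nonempty) {e : E(G)} (he : e ∈ F)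
    (hs : 0 ≤ s e) : F.inf' hFne s ≤ contribution G.spanningTrees h𝓕 e s := by
  obtain ⟨T, hT, hTmin⟩ := exists_minWeight_eq (h𝓕 := h𝓕) s
  have hT' := mem_spanningTrees.1 hT
  have hmem : ∀ g : E(G), g.1 ∈ Subtype.val '' (F : Set E(G)) ↔ g ∈ F := fun g => by simp
  obtain ⟨f, hf, hfF, hex⟩ := hF.exists_exchange hV hG ((hmem e).2 he) hT'
  have h1 := minWeight_le (h𝓕 := h𝓕) (Function.update s e 0) (mem_spanningTrees.2 hex)
  have h2 : ∑ i ∈ T.erase f, s i = minWeight G.spanningTrees h𝓕 s - s f := by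
    rw [hTmin, ← Finset.add_sum_erase _ _ hf]; ring
  have h3 := F.inf'_le s ((hmem f).1 hfF)
  have h4 : ∑ i ∈ (insert e (T.erase f)).erase e, s i ≤ ∑ i ∈ T.erase f, s i := by
    refine Finset.sum_le_sum_of_subset_of_nonneg
      ((Finset.erase_insert_eq_erase _ _).trans_subset (Finset.erase_subset _ _)) fun i hi hi' => ?_
    obtain rfl : i = e := by_contra fun hie =>
      hi' (Finset.mem_erase.2 ⟨hie, Finset.mem_insert_of_mem hi⟩)
    exact hs
  rw [sum_update_of_mem (Finset.mem_insert_self _ _)] at h1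
  rw [contribution]
  linarith

end Contribution

/-! ### Expected cost of the algorithm: formula, upper bound, sharpness -/

section Cost

variable {r : E(G) → ℝ} {A : (E(G) → ℝ) → Finset E(G)}

lemma weightLaw_def (r : E(G) → ℝ) : G.weightLaw r = Measure.pi fun e => expMeasure (r e) := rfl

lemma isProbabilityMeasure_weightLaw (hr : ∀ e, 0 < r e) :
    IsProbabilityMeasure (G.weightLaw r) := by
  have : ∀ i, IsProbabilityMeasure (expMeasure (r i)) :=
    fun i => isProbabilityMeasure_expMeasure (hr i)
  rw [weightLaw_def]
  infer_instance

lemma integral_weight (hr : ∀ e, 0 < r e) (T : Finset E(G)) :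
    ∫ w, weight w T ∂(G.weightLaw r) = ∑ e ∈ T, (r e)⁻¹ := by
  unfold weight
  rw [weightLaw_def, integral_finsetSum _ fun e _ => integrable_eval_expMeasure hr e]
  exact Finset.sum_congr rfl fun e _ => integral_eval_expMeasure hr e

lemma opt_le (hr : ∀ e, 0 < r e) {T : Finset E(G)} (hT : G.IsSpanningTree T) :
    G.opt r ≤ ∑ e ∈ T, (r e)⁻¹ := by
  refine csInf_le ⟨0, ?_⟩ ⟨T, hT, (integral_weight hr T).symm⟩
  rintro c ⟨T', -, rfl⟩
  rw [integral_weight hr]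
  exact Finset.sum_nonneg fun e _ => (inv_pos.2 (hr e)).le

lemma opt_nonneg (hr : ∀ e, 0 < r e) : 0 ≤ G.opt r := by
  refine Real.sInf_nonneg ?_
  rintro c ⟨T', -, rfl⟩
  rw [integral_weight hr]
  exact Finset.sum_nonneg fun e _ => (inv_pos.2 (hr e)).le

lemma IsSAM.mem (hA : G.IsSAM A) (s : E(G) → ℝ) : A s ∈ G.spanningTrees :=
  mem_spanningTrees.2 (hA s).1

lemma IsSAM.nonempty (hA : G.IsSAM A) : G.spanningTrees.Nonempty := ⟨_, hA.mem 0⟩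

lemma IsSAM.sum_eq (hA : G.IsSAM A) (s : E(G) → ℝ) :
    ∑ e ∈ A s, s e = minWeight G.spanningTrees hA.nonempty s :=
  le_antisymm (Finset.le_inf' _ _ fun T hT => (hA s).2 T (mem_spanningTrees.1 hT))
    (minWeight_le s (hA.mem s))

/-- Separates the dependence on the sample from that on the actual weights, so integrability and
expectations factor edge by edge. -/
lemma weight_eq_sum [DecidableEq E(G)] (s w : E(G) → ℝ) :
    weight w (A s) = ∑ e, {s | e ∈ A s}.indicator 1 s * w e := by
  have : ∀ e, ({s | e ∈ A s} : Set (E(G) → ℝ)).indicator 1 s * w e =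
      if e ∈ A s then w e else 0 := fun e => by
    by_cases h : e ∈ A s <;> simp [h]
  simp only [this, Finset.sum_ite_mem, Finset.univ_inter, weight]

lemma IsSAM.integrable_indicator (hA : G.IsSAM A) (hr : ∀ e, 0 < r e) (e : E(G)) :
    Integrable ({s | e ∈ A s}.indicator (1 : (E(G) → ℝ) → ℝ)) (G.weightLaw r) := by
  classical
  have := isProbabilityMeasure_weightLaw hr
  exact (integrable_const (1 : ℝ)).indicator₀ (measure_mem_optimal hr hA.mem hA.sum_eq e).1

lemma IsSAM.integrable (hA : G.IsSAM A) (hr : ∀ e, 0 < r e) :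
    Integrable (fun p : (E(G) → ℝ) × (E(G) → ℝ) => weight p.2 (A p.1))
      ((G.weightLaw r).prod (G.weightLaw r)) := by
  classical
  have := isProbabilityMeasure_weightLaw hr
  simp only [weight_eq_sum (A := A)]
  exact integrable_finsetSum _ fun e _ =>
    (hA.integrable_indicator hr e).mul_prod (integrable_eval_expMeasure hr e)

lemma IsSAM.expectedCost_eq [DecidableEq E(G)] (hA : G.IsSAM A) (hr : ∀ e, 0 < r e) :
    G.expectedCost r A =
      ∑ e, ∫ s, contribution G.spanningTrees hA.nonempty e s ∂(G.weightLaw r) := by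
  have := isProbabilityMeasure_weightLaw hr
  have h1 : ∀ s, ∫ w, weight w (A s) ∂(G.weightLaw r) =
      ∑ e, {s | e ∈ A s}.indicator 1 s * (r e)⁻¹ := fun s => by
    rw [integral_weight hr]
    exact weight_eq_sum s fun e => (r e)⁻¹
  unfold expectedCost
  simp only [h1]
  rw [integral_finsetSum _ fun e _ => (hA.integrable_indicator hr e).mul_const _]
  refine Finset.sum_congr rfl fun e _ => ?_
  rw [integral_mul_const, weightLaw_def,
    integral_indicator₀ (measure_mem_optimal hr hA.mem hA.sum_eq e).1]
  simp only [Pi.one_apply, integral_const, smul_eq_mul, mul_one, measureReal_restrict_apply_univ]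
  exact measureReal_mem_optimal hr hA.mem hA.sum_eq e

lemma IsSAM.integrable_minWeight (hA : G.IsSAM A) (hr : ∀ e, 0 < r e) :
    Integrable (minWeight G.spanningTrees hA.nonempty) (G.weightLaw r) := by
  have hT := hA.mem 0
  refine (integrable_finsetSum (A 0) fun e _ => integrable_eval_expMeasure hr e).mono'
    (continuous_minWeight _ _).measurable.aestronglyMeasurable ?_
  filter_upwards [ae_nonneg_pi_expMeasure hr] with s hs
  rw [Real.norm_of_nonneg (minWeight_nonneg hs)]
  exact minWeight_le s hT

/-- The sampling based algorithm costs at most `maxBondSize` times the optimum. -/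
theorem IsSAM.expectedCost_le (hV : V(G).Finite) (hG : G.IsConnected) (hA : G.IsSAM A)
    (hr : ∀ e, 0 < r e) : G.expectedCost r A ≤ G.maxBondSize * G.opt r := by
  classical
  have hmin := hA.integrable_minWeight hr
  -- The mean of a minimum is at most each of the means.
  have hopt : ∫ s, minWeight G.spanningTrees hA.nonempty s ∂(G.weightLaw r) ≤ G.opt r := by
    refine le_csInf ⟨_, A 0, (hA 0).1, rfl⟩ ?_
    rintro c ⟨T, hT, rfl⟩
    exact integral_mono hmin (integrable_finsetSum T fun e _ => integrable_eval_expMeasure hr e)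
      fun s => minWeight_le s (mem_spanningTrees.2 hT)
  refine le_trans ?_ (mul_le_mul_of_nonneg_left hopt (Nat.cast_nonneg _))
  rw [hA.expectedCost_eq hr, ← integral_const_mul]
  refine (integral_finsetSum _ fun e _ => integrable_contribution hr e).symm.trans_le ?_
  refine integral_mono_ae (integrable_finsetSum _ fun e _ => integrable_contribution hr e)
    (hmin.const_mul _) ?_
  filter_upwards [ae_nonneg_pi_expMeasure hr] with s hs
  exact sum_contribution_le hV hG hs

/-- Every bond gives a lower bound on the cost of the sampling based algorithm. -/
theorem IsSAM.le_expectedCost (hV : V(G).Finite) (hG : G.IsConnected) (hA : G.IsSAM A)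
    (hr : ∀ e, 0 < r e) {F : Finset E(G)} (hF : G.IsBond (Subtype.val '' (F : Set E(G))))
    (hFne : F.Nonempty) : F.card * (∑ e ∈ F, r e)⁻¹ ≤ G.expectedCost r A := by
  classical
  obtain ⟨hint, hval⟩ := integral_inf'_expMeasure hr hFne
  rw [hA.expectedCost_eq hr, ← nsmul_eq_mul, ← Finset.sum_const]
  have hnn : ∀ e, 0 ≤ ∫ s, contribution G.spanningTrees hA.nonempty e s ∂(G.weightLaw r) :=
    fun e => integral_nonneg_of_ae (by
      filter_upwards [ae_nonneg_pi_expMeasure hr] with s hs using contribution_nonneg (hs e))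
  refine (Finset.sum_le_sum fun e he => ?_).trans
    (Finset.sum_le_univ_sum_of_nonneg (s := F) hnn)
  rw [← hval]
  refine integral_mono_ae hint (integrable_contribution hr e) ?_
  filter_upwards [ae_nonneg_pi_expMeasure hr] with s hs
  exact le_contribution hV hG hF hFne he (hs e)

lemma IsSAM.expectedCost_nonneg (hA : G.IsSAM A) (hr : ∀ e, 0 < r e) :
    0 ≤ G.expectedCost r A := by
  classical
  rw [hA.expectedCost_eq hr]
  exact Finset.sum_nonneg fun e _ => integral_nonneg_of_ae (by
      filter_upwards [ae_nonneg_pi_expMeasure hr] with s hs using contribution_nonneg (hs e))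

/-- The rates concentrating the cost on the edge `e` of the set `F`. -/
lemma exists_rates (F : Finset E(G)) {e : E(G)} (he : e ∈ F) {η : ℝ} (hη : 0 < η) :
    ∃ r : E(G) → ℝ, (∀ i, 0 < r i) ∧ ∑ i ∈ F, r i ≤ 1 + η ∧
      ∀ T : Finset E(G), (∀ i ∈ T, i ∈ F → i = e) → ∑ i ∈ T, (r i)⁻¹ ≤ 1 + η := by
  classical
  set N : ℝ := Fintype.card E(G) + 1 with hN
  have hNpos : 0 < N := by positivity
  set δ : ℝ := η / N with hδ
  have hδpos : 0 < δ := div_pos hη hNpos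
  have hbound : ∀ T : Finset E(G), (T.card : ℝ) * δ ≤ η := fun T => by
    have h1 : (T.card : ℝ) ≤ N :=
      (Nat.cast_le.2 T.card_le_univ).trans (by rw [hN]; linarith)
    calc (T.card : ℝ) * δ ≤ N * δ := mul_le_mul_of_nonneg_right h1 hδpos.le
      _ = η := by rw [hδ]; field_simp
  -- Other edges of `F` add only δ each to the total rate, and edges outside `F` add only δ each to
  -- the mean weight; δ = η / (|E| + 1) keeps either sum below η.
  refine ⟨fun i => if i = e then 1 else if i ∈ F then δ else δ⁻¹, fun i => ?_, ?_, fun T hT => ?_⟩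
  · dsimp only
    split_ifs <;> positivity
  · rw [← Finset.add_sum_erase _ _ he]
    simp only [if_true]
    gcongr
    rw [Finset.sum_congr rfl (g := fun _ => δ) fun i hi => ?_, Finset.sum_const, nsmul_eq_mul]
    · exact hbound _
    · rw [if_neg (Finset.ne_of_mem_erase hi), if_pos (Finset.mem_of_mem_erase hi)]
  · calc _ ≤ ∑ i ∈ T, ((if i = e then 1 else 0) + δ) := by
          refine Finset.sum_le_sum fun i hi => ?_
          by_cases hie : i = e
          · simp [hie, hδpos.le]
          · have hiF : i ∉ F := fun h => hie (hT i hi h)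
            simp [hie, hiF]
      _ ≤ 1 + η := by
          rw [Finset.sum_add_distrib, Finset.sum_const, nsmul_eq_mul]
          refine add_le_add ?_ (hbound T)
          rw [Finset.sum_ite_eq']
          split_ifs <;> norm_num

/-- The bound by `maxBondSize` is sharp. -/
theorem exists_rates_expectedCost_ge (hV : V(G).Finite) (hG : G.IsConnected) {ε : ℝ}
    (hε : 0 < ε) : ∃ r : E(G) → ℝ, (∀ e, 0 < r e) ∧ ∀ A, G.IsSAM A →
      (G.maxBondSize - ε) * G.opt r ≤ G.expectedCost r A := by
  -- Here the factor is nonpositive and any rates do; this includes the case without bonds.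
  by_cases hb : (G.maxBondSize : ℝ) ≤ ε
  · refine ⟨fun _ => 1, fun _ => one_pos, fun A hA => ?_⟩
    exact (mul_nonpos_of_nonpos_of_nonneg (sub_nonpos.2 hb) (opt_nonneg fun _ => one_pos)).trans
      (hA.expectedCost_nonneg fun _ => one_pos)
  push Not at hb
  have hbpos : (0 : ℝ) < G.maxBondSize := hε.trans hb
  obtain ⟨F', hF', hcard⟩ := exists_isBond_ncard_eq (G := G) (by
    intro h; rw [h, Nat.cast_zero] at hbpos; exact lt_irrefl _ hbpos)
  obtain ⟨F, rfl⟩ : ∃ F : Finset E(G), Subtype.val '' (F : Set E(G)) = F' := by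
    classical
    refine ⟨Finset.univ.filter fun e => e.1 ∈ F', ?_⟩
    ext x
    simp only [Finset.coe_filter, Finset.mem_univ, true_and, Set.mem_image, Set.mem_ofPred_eq]
    exact ⟨by rintro ⟨e, he, rfl⟩; exact he, fun hx => ⟨⟨x, hF'.1.1 hx⟩, hx, rfl⟩⟩
  rw [Set.ncard_image_of_injective _ Subtype.val_injective, Set.ncard_coe_finset] at hcard
  have hFne : F.Nonempty := Finset.card_pos.1 (by rw [hcard]; exact_mod_cast hbpos)
  obtain ⟨e, he⟩ := hFne
  -- The optimum and the total rate of the bond each cost a factor 1 + η. For η ≤ 1 one has (1 + η)²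
  -- ≤ 1 + 3η, so (b - ε)(1 + η)² ≤ b - ε + 3bη ≤ b.
  obtain ⟨η, hη, hη1, hηε⟩ : ∃ η : ℝ, 0 < η ∧ η ≤ 1 ∧ 3 * G.maxBondSize * η ≤ ε := by
    refine ⟨min 1 (ε / (3 * G.maxBondSize)), by positivity, min_le_left _ _, ?_⟩
    calc 3 * G.maxBondSize * min 1 (ε / (3 * G.maxBondSize))
        ≤ 3 * G.maxBondSize * (ε / (3 * G.maxBondSize)) := by gcongr; exact min_le_right _ _
      _ = ε := by field_simp
  obtain ⟨r, hr, hrF, hrT⟩ := exists_rates F he hη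
  refine ⟨r, hr, fun A hA => ?_⟩
  obtain ⟨T, hT, hTF⟩ := hF'.exists_isSpanningTree hV hG (e := e) ⟨e, he, rfl⟩
  have hopt : G.opt r ≤ 1 + η := (opt_le hr hT).trans
    (hrT T fun i hi hiF => hTF i hi ⟨i, hiF, rfl⟩)
  refine le_trans ?_ (hA.le_expectedCost hV hG hr hF' ⟨e, he⟩)
  rw [hcard]
  have hRpos : 0 < ∑ i ∈ F, r i := Finset.sum_pos (fun i _ => hr i) ⟨e, he⟩
  rw [← div_eq_mul_inv, le_div_iff₀ hRpos]
  have hbε : 0 ≤ (G.maxBondSize : ℝ) - ε := sub_nonneg.2 hb.le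
  calc (G.maxBondSize - ε) * G.opt r * ∑ i ∈ F, r i
      ≤ (G.maxBondSize - ε) * (1 + η) * (1 + η) := by gcongr
    _ ≤ G.maxBondSize := by
        nlinarith [mul_nonneg hε.le hη.le, mul_nonneg hbε (mul_nonneg hη.le (sub_nonneg.2 hη1))]

end Cost

end Graph

end

theorem theorem1 {α β : Type*} (G : Graph α β) [G.Loopless] (hV : V(G).Finite) [Fintype E(G)]
    (hG : G.IsConnected) :
    (∀ r : E(G) → ℝ, (∀ e, 0 < r e) → ∀ A, G.IsSAM A →
      Integrable (fun p : (E(G) → ℝ) × (E(G) → ℝ) => Graph.weight p.2 (A p.1))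
          ((G.weightLaw r).prod (G.weightLaw r)) ∧
        G.expectedCost r A ≤ G.maxBondSize * G.opt r) ∧
    (∀ ε : ℝ, 0 < ε → ∃ r : E(G) → ℝ, (∀ e, 0 < r e) ∧ ∀ A, G.IsSAM A →
      (G.maxBondSize - ε) * G.opt r ≤ G.expectedCost r A) :=
  ⟨fun _ hr _ hA => ⟨hA.integrable hr, hA.expectedCost_le hV hG hr⟩,
    fun _ hε => Graph.exists_rates_expectedCost_ge hV hG hε⟩
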